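/- Let $d\in\mathbb N$, $L\ge 0$, let $\mathscr L$ be the Lebesgue measure on $\mathbb R^d$, and let $$G=\{g:\mathbb R^d\to\mathbb R^d \;:\; g \text{ is } L\text{-Lipschitz and } g=\nabla\varphi\ \ \mathscr L\text{-a.e. for some convex } \varphi:\mathbb R^d\to\mathbb R\},$$ where Lipschitz is meant for the Euclidean norm. Let $\mu$ be a Borel probability measure on $\mathbb R^d$ with $\int\|x\|_2^2\,\mathrm d\mu(x)<+\infty$ and $\mu\ll\mathscr L$. For Borel probability measures $\nu_1,\nu_2$ on $\mathbb R^d$ let $$W_2^2(\nu_1,\nu_2)=\inf_{\pi\in\Pi(\nu_1,\nu_2)}\int\|x-y\|_2^2\,\mathrm d\pi(x,y),$$ where $\Pi(\nu_1,\nu_2)$ is the set of probability measures on $\mathbb R^d\times\mathbb R^d$ with first marginal $\nu_1$ and second marginal $\nu_2$. If $g_0$ and $g_1$ are both solutions of the problem $$\operatorname*{argmin}_{g\in G}\ W_2^2(g\#\mu,\mu),$$ where $g\#\mu$ denotes the push-forward of $\mu$ by $g$, then $g_0(x)=g_1(x)$ for every $x\in\operatorname{supp}(\mu)$. -/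

import Mathlib

open MeasureTheory
open scoped NNReal ENNReal

/-- The couplings `Π(ν₁, ν₂)`: measures on the product whose first and second marginals are
`ν₁` and `ν₂` (they are probability measures as soon as `ν₁` is). -/
def couplings {X Y : Type*} [MeasurableSpace X] [MeasurableSpace Y]
    (ν₁ : Measure X) (ν₂ : Measure Y) : Set (Measure (X × Y)) :=
  {π | π.map Prod.fst = ν₁ ∧ π.map Prod.snd = ν₂}

/-- The optimal transport cost `T_c(ν₁, ν₂)` for the ground cost `c`, with values
in `[0, +∞]`. -/
noncomputable def transportCost {X Y : Type*} [MeasurableSpace X] [MeasurableSpace Y]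
    (c : X → Y → ℝ≥0∞) (ν₁ : Measure X) (ν₂ : Measure Y) : ℝ≥0∞ :=
  ⨅ π ∈ couplings ν₁ ν₂, ∫⁻ p, c p.1 p.2 ∂π

/-- The Wasserstein distance `W₂` on `ℝ^d`, for the Euclidean norm. -/
noncomputable def wasserstein2 {d : ℕ} (ν₁ ν₂ : Measure (EuclideanSpace ℝ (Fin d))) : ℝ≥0∞ :=
  (transportCost (fun x y => ‖x - y‖ₑ ^ 2) ν₁ ν₂) ^ (1 / 2 : ℝ)

/-- The class of `L`-Lipschitz maps `g : ℝ^d → ℝ^d` that agree Lebesgue-almost everywhere with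
the gradient of a convex function `φ : ℝ^d → ℝ` (which is differentiable there). -/
def lipschitzConvexGradients (d : ℕ) (L : ℝ≥0) :
    Set (EuclideanSpace ℝ (Fin d) → EuclideanSpace ℝ (Fin d)) :=
  {g | LipschitzWith L g ∧ ∃ φ : EuclideanSpace ℝ (Fin d) → ℝ,
    ConvexOn ℝ Set.univ φ ∧ ∀ᵐ x ∂volume, HasGradientAt φ (g x) x}

/-- `g` solves the problem `argmin_{g ∈ G} W₂²(g#μ, ν)`. -/
def IsMapProblemSolution {d : ℕ}
    (G : Set (EuclideanSpace ℝ (Fin d) → EuclideanSpace ℝ (Fin d)))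
    (μ ν : Measure (EuclideanSpace ℝ (Fin d)))
    (g : EuclideanSpace ℝ (Fin d) → EuclideanSpace ℝ (Fin d)) : Prop :=
  g ∈ G ∧ ∀ h ∈ G, wasserstein2 (μ.map g) ν ^ 2 ≤ wasserstein2 (μ.map h) ν ^ 2

/-! A gradient of a convex function is an optimal transport map, so for `g` in the class the
coupling `(g x, x)` is optimal and the objective is `∫ ‖g x - x‖ ^ 2 ∂μ`
(`transportCost_map_eq_of_subgradient`, by Kantorovich duality). This is strictly convex in `L²(μ)`
(`integral_norm_midpoint_sub_sq`) and the class is stable under midpoints, so two minimizers agree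
`μ`-a.e.; being continuous, they agree on the support. -/

theorem lintegral_enorm_sub_sq_eq_ofReal {α E : Type*} [MeasurableSpace α]
    [NormedAddCommGroup E] {μ : Measure α} {f g : α → E}
    (hf : MemLp f 2 μ) (hg : MemLp g 2 μ) :
    ∫⁻ x, ‖f x - g x‖ₑ ^ 2 ∂μ = ENNReal.ofReal (∫ x, ‖f x - g x‖ ^ 2 ∂μ) := by
  have hi : Integrable (fun x => ‖f x - g x‖ ^ 2) μ :=
    (hf.sub hg).integrable_norm_pow two_ne_zero
  rw [ofReal_integral_eq_lintegral_ofReal hi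
    (Filter.Eventually.of_forall fun x => by positivity)]
  refine lintegral_congr fun x => ?_
  rw [ENNReal.ofReal_pow (norm_nonneg _), ofReal_norm]

/-- A Lipschitz map is in `L^p` for every finite measure with a finite `p`-th moment. -/
theorem LipschitzWith.memLp_of_memLp_id {F : Type*} [NormedAddCommGroup F] [MeasurableSpace F]
    [BorelSpace F] [SecondCountableTopology F] {μ : Measure F} [IsFiniteMeasure μ] {K : ℝ≥0}
    {g : F → F} {p : ℝ≥0∞} (hg : LipschitzWith K g) (hμ : MemLp id p μ) : MemLp g p μ := by
  have h0 : MemLp (fun x => K * ‖x‖ + ‖g 0‖) p μ :=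
    (hμ.norm.const_mul (K : ℝ)).add (memLp_const _)
  refine h0.mono hg.continuous.aestronglyMeasurable (Filter.Eventually.of_forall fun x => ?_)
  rw [Real.norm_of_nonneg (by positivity)]
  calc ‖g x‖ ≤ ‖g x - g 0‖ + ‖g 0‖ := norm_le_norm_sub_add _ _
    _ ≤ K * ‖x‖ + ‖g 0‖ := by
      gcongr
      simpa [dist_eq_norm] using hg.dist_le_mul x 0

section ConvexGradients

variable {E : Type*} [NormedAddCommGroup E] [InnerProductSpace ℝ E]

/-- The gradient of a convex function is a subgradient. -/
theorem ConvexOn.add_inner_gradient_le [CompleteSpace E] {φ : E → ℝ}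
    (hφ : ConvexOn ℝ Set.univ φ) {z v : E} (hz : HasGradientAt φ v z) (x : E) :
    φ z + inner ℝ v (x - z) ≤ φ x := by
  have hline : ConvexOn ℝ Set.univ (φ ∘ AffineMap.lineMap (k := ℝ) z x) := by
    simpa using hφ.comp_affineMap (AffineMap.lineMap (k := ℝ) z x)
  have hderiv : HasDerivAt (φ ∘ AffineMap.lineMap (k := ℝ) z x) (inner ℝ v (x - z)) 0 := by
    have hz' : HasFDerivAt φ (InnerProductSpace.toDual ℝ E v)
        (AffineMap.lineMap (k := ℝ) z x (0 : ℝ)) := by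
      simpa using hz.hasFDerivAt
    simpa using hz'.comp_hasDerivAt (0 : ℝ) AffineMap.hasDerivAt_lineMap
  have h := hline.le_slope_of_hasDerivAt (Set.mem_univ 0) (Set.mem_univ 1) one_pos hderiv
  simp only [slope_def_field, Function.comp_apply, AffineMap.lineMap_apply_zero,
    AffineMap.lineMap_apply_one, sub_zero, div_one] at h
  linarith

/-- A continuous map which is almost everywhere the gradient of a convex function is
everywhere a selection of its subdifferential. -/
theorem ConvexOn.add_inner_le_of_ae_hasGradientAt [FiniteDimensional ℝ E] [MeasurableSpace E]
    {ν : Measure E} [ν.IsOpenPosMeasure] {φ : E → ℝ} {g : E → E}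
    (hφ : ConvexOn ℝ Set.univ φ) (hg : Continuous g) (h : ∀ᵐ x ∂ν, HasGradientAt φ (g x) x)
    (z x : E) : φ z + inner ℝ (g z) (x - z) ≤ φ x := by
  have hc : Continuous φ := continuousOn_univ.1 (hφ.continuousOn isOpen_univ)
  have hclosed : IsClosed {z | φ z + inner ℝ (g z) (x - z) ≤ φ x} :=
    isClosed_le (by fun_prop) continuous_const
  have hdense : Dense {z | φ z + inner ℝ (g z) (x - z) ≤ φ x} :=
    Measure.dense_of_ae (h.mono fun z hz => hφ.add_inner_gradient_le hz x)
  exact hclosed.closure_subset (hdense z)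

/-- A measurable function that plays the role of the convex conjugate of `φ` on the range of a
selection `g` of its subdifferential. -/
theorem exists_measurable_conjugate [SecondCountableTopology E] [MeasurableSpace E]
    [BorelSpace E] {φ : E → ℝ} {g : E → E} (hφ : Continuous φ)
    (h : ∀ z x, φ z + inner ℝ (g z) (x - z) ≤ φ x) :
    ∃ ψ : E → ℝ, Measurable ψ ∧ (∀ z, ψ (g z) = inner ℝ (g z) z - φ z) ∧
      MeasurableSet {y | ∀ x, inner ℝ y x ≤ φ x + ψ y} := by
  let u := TopologicalSpace.denseSeq E
  have hu : DenseRange u := TopologicalSpace.denseRange_denseSeq E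
  -- A countable supremum keeps the conjugate measurable; continuity of `φ` makes it the full
  -- supremum wherever it is finite. Elsewhere the real `⨆` defaults to `0`, so Young's inequality
  -- can fail there.
  have hmeas : Measurable fun y => ⨆ n, (inner ℝ y (u n) - φ (u n)) :=
    Measurable.iSup fun n => by fun_prop
  refine ⟨fun y => ⨆ n, (inner ℝ y (u n) - φ (u n)), hmeas, fun z => ?_, ?_⟩
  · have hle : ∀ x, inner ℝ (g z) x - φ x ≤ inner ℝ (g z) z - φ z := fun x => by
      have := h z x
      rw [inner_sub_right] at this
      linarith
    refine le_antisymm (ciSup_le fun n => hle _) ?_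
    have hbdd : BddAbove (Set.range fun n => inner ℝ (g z) (u n) - φ (u n)) :=
      ⟨_, by rintro _ ⟨n, rfl⟩; exact hle _⟩
    exact hu.induction_on (p := fun x => inner ℝ (g z) x - φ x ≤
        ⨆ n, (inner ℝ (g z) (u n) - φ (u n))) z
      (isClosed_le (by fun_prop) continuous_const) (fun n => le_ciSup hbdd n)
  · have : {y | ∀ x, inner ℝ y x ≤ φ x + ⨆ n, (inner ℝ y (u n) - φ (u n))} =
        ⋂ k, {y | inner ℝ y (u k) ≤ φ (u k) + ⨆ n, (inner ℝ y (u n) - φ (u n))} := by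
      ext y
      simp only [Set.mem_ofPred_eq, Set.mem_iInter]
      refine ⟨fun hy k => hy (u k), fun hy x => ?_⟩
      exact hu.induction_on (p := fun x => inner ℝ y x ≤
          φ x + ⨆ n, (inner ℝ y (u n) - φ (u n))) x
        (isClosed_le (by fun_prop) (by fun_prop)) hy
    rw [this]
    exact MeasurableSet.iInter fun k => measurableSet_le (by fun_prop) (by fun_prop)

/-- Square integrable functions have an integrable pointwise inner product. -/
theorem MeasureTheory.MemLp.integrable_inner {α : Type*} [MeasurableSpace α] {μ : Measure α}
    {f g : α → E} (hf : MemLp f 2 μ) (hg : MemLp g 2 μ) :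
    Integrable (fun x => inner ℝ (f x) (g x)) μ := by
  refine (hf.norm.integrable_mul hg.norm).mono (hf.1.inner hg.1)
    (Filter.Eventually.of_forall fun x => ?_)
  simpa using abs_real_inner_le_norm (f x) (g x)

/-- A continuous function with a square integrable selection of its subdifferential is integrable
for a measure with finite second moment. -/
theorem integrable_of_subgradient [SecondCountableTopology E] [MeasurableSpace E] [BorelSpace E]
    {μ : Measure E} [IsFiniteMeasure μ] {φ : E → ℝ} {g : E → E} (hφ : Continuous φ)
    (h : ∀ z x, φ z + inner ℝ (g z) (x - z) ≤ φ x) (hμ : MemLp id 2 μ) (hg : MemLp g 2 μ) :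
    Integrable φ μ := by
  have h1 : Integrable (fun x => inner ℝ (g x) x) μ := hg.integrable_inner hμ
  have h2 : Integrable (fun x => inner ℝ (g 0) x) μ := (memLp_const (g 0)).integrable_inner hμ
  -- Lower bound: the subgradient at `0`. Upper bound: the subgradient at `x`, tested at `0`.
  refine integrable_of_le_of_le hφ.aestronglyMeasurable
    (Filter.Eventually.of_forall fun x => ?_) (Filter.Eventually.of_forall fun x => ?_)
    ((integrable_const (φ 0)).add h2) ((integrable_const (φ 0)).add h1)
  · simpa using h 0 x
  · have := h x 0
    simp only [zero_sub, inner_neg_right] at this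
    simp only [Pi.add_apply]
    linarith

/-- A selection of the subdifferential of a convex function is an optimal transport map from `μ`
to its push-forward for the quadratic cost. -/
theorem integral_norm_sub_sq_le_of_subgradient [SecondCountableTopology E] [MeasurableSpace E]
    [BorelSpace E] {μ : Measure E} [IsFiniteMeasure μ] {φ : E → ℝ} {g : E → E}
    (hφ : Continuous φ) (h : ∀ z x, φ z + inner ℝ (g z) (x - z) ≤ φ x)
    (hμ : MemLp id 2 μ) (hg : MemLp g 2 μ) {π : Measure (E × E)}
    (hπ : π ∈ couplings (μ.map g) μ) :
    ∫ x, ‖g x - x‖ ^ 2 ∂μ ≤ ∫ p, ‖p.1 - p.2‖ ^ 2 ∂π := by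
  obtain ⟨hπ₁, hπ₂⟩ := hπ
  have hgm : AEMeasurable g μ := hg.1.aemeasurable
  obtain ⟨ψ, hψm, hψ, hset⟩ := exists_measurable_conjugate hφ h
  have hφi : Integrable φ μ := integrable_of_subgradient hφ h hμ hg
  have hgi : Integrable (fun x => inner ℝ (g x) x) μ := hg.integrable_inner hμ
  have hgn : Integrable (fun x => ‖g x‖ ^ 2) μ := hg.integrable_norm_pow two_ne_zero
  have hxn : Integrable (fun x : E => ‖x‖ ^ 2) μ := hμ.integrable_norm_pow two_ne_zero
  -- Dual potentials: `a y + b x ≤ ‖y - x‖ ^ 2` is Young's inequality `⟪y, x⟫ ≤ φ x + ψ y`, with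
  -- equality at `y = g x`.
  let a : E → ℝ := fun y => ‖y‖ ^ 2 - 2 * ψ y
  let b : E → ℝ := fun x => ‖x‖ ^ 2 - 2 * φ x
  have ham : Measurable a := by fun_prop
  have hag : a ∘ g = fun x => ‖g x‖ ^ 2 - 2 * (inner ℝ (g x) x - φ x) := by
    ext x
    simp [a, hψ]
  have hagi : Integrable (a ∘ g) μ := hag ▸ hgn.sub ((hgi.sub hφi).const_mul 2)
  have hbi : Integrable b μ := hxn.sub (hφi.const_mul 2)
  have hai : Integrable a (μ.map g) := (integrable_map_measure ham.aestronglyMeasurable hgm).2 hagi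
  have hai' : Integrable (fun p : E × E => a p.1) π :=
    (hπ₁ ▸ hai : Integrable a (π.map Prod.fst)).comp_measurable measurable_fst
  have hbi' : Integrable (fun p : E × E => b p.2) π :=
    (hπ₂ ▸ hbi : Integrable b (π.map Prod.snd)).comp_measurable measurable_snd
  have hfst : MemLp (Prod.fst : E × E → E) 2 π := by
    have : MemLp id 2 (μ.map g) := (memLp_map_measure_iff aestronglyMeasurable_id hgm).2 hg
    rw [← hπ₁] at this
    exact this.comp_of_map measurable_fst.aemeasurable
  have hsnd : MemLp (Prod.snd : E × E → E) 2 π := by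
    rw [← hπ₂] at hμ
    exact hμ.comp_of_map measurable_snd.aemeasurable
  have hci : Integrable (fun p : E × E => ‖p.1 - p.2‖ ^ 2) π :=
    (hfst.sub hsnd).integrable_norm_pow two_ne_zero
  -- Young's inequality is only known on the range of `g`; this suffices because the first marginal
  -- of `π` is `μ.map g`.
  have hyoung : ∀ᵐ p ∂π, ∀ x, inner ℝ p.1 x ≤ φ x + ψ p.1 := by
    have h1 : ∀ᵐ y ∂(μ.map g), ∀ x, inner ℝ y x ≤ φ x + ψ y := by
      refine (ae_map_iff hgm hset).2 (Filter.Eventually.of_forall fun z x => ?_)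
      have := h z x
      rw [inner_sub_right] at this
      rw [hψ]
      linarith
    rw [← hπ₁] at h1
    exact ae_of_ae_map measurable_fst.aemeasurable h1
  calc ∫ x, ‖g x - x‖ ^ 2 ∂μ = ∫ x, ((a ∘ g) x + b x) ∂μ := by
        refine integral_congr_ae (Filter.Eventually.of_forall fun x => ?_)
        simp only [hag, b, norm_sub_sq_real]
        ring
    _ = ∫ y, a y ∂(μ.map g) + ∫ x, b x ∂μ := by
        rw [integral_add hagi hbi, integral_map hgm ham.aestronglyMeasurable]
        rfl
    _ = ∫ p, a p.1 ∂π + ∫ p, b p.2 ∂π := by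
        congr 1
        · rw [← hπ₁] at hai ⊢
          exact integral_map measurable_fst.aemeasurable hai.1
        · conv_lhs => rw [← hπ₂]
          rw [← hπ₂] at hbi
          exact integral_map measurable_snd.aemeasurable hbi.1
    _ = ∫ p, (a p.1 + b p.2) ∂π := (integral_add hai' hbi').symm
    _ ≤ ∫ p, ‖p.1 - p.2‖ ^ 2 ∂π := by
        refine integral_mono_ae (hai'.add hbi') hci (hyoung.mono fun p hp => ?_)
        have := hp p.2
        simp only [a, b, norm_sub_sq_real]
        linarith

/-- The optimal quadratic transport cost between `g#μ` and `μ`, when `g` is a selection of the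
subdifferential of a convex function. -/
theorem transportCost_map_eq_of_subgradient [SecondCountableTopology E] [MeasurableSpace E]
    [BorelSpace E] {μ : Measure E} [IsFiniteMeasure μ] {φ : E → ℝ} {g : E → E}
    (hφ : Continuous φ) (h : ∀ z x, φ z + inner ℝ (g z) (x - z) ≤ φ x)
    (hμ : MemLp id 2 μ) (hgm : Measurable g) (hg : MemLp g 2 μ) :
    transportCost (fun x y => ‖x - y‖ₑ ^ 2) (μ.map g) μ =
      ENNReal.ofReal (∫ x, ‖g x - x‖ ^ 2 ∂μ) := by
  refine le_antisymm ?_ (le_iInf₂ fun π hπ => ?_)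
  · have hpair : Measurable fun x => (g x, x) := hgm.prodMk measurable_id
    have hmem : μ.map (fun x => (g x, x)) ∈ couplings (μ.map g) μ := by
      constructor
      · rw [Measure.map_map measurable_fst hpair]
        rfl
      · rw [Measure.map_map measurable_snd hpair]
        exact Measure.map_id
    refine (iInf₂_le _ hmem).trans_eq ?_
    rw [lintegral_map (by fun_prop) hpair]
    exact lintegral_enorm_sub_sq_eq_ofReal hg hμ
  · have hfst : MemLp (Prod.fst : E × E → E) 2 π := by
      have : MemLp id 2 (μ.map g) :=
        (memLp_map_measure_iff aestronglyMeasurable_id hgm.aemeasurable).2 hg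
      rw [← hπ.1] at this
      exact this.comp_of_map measurable_fst.aemeasurable
    have hsnd : MemLp (Prod.snd : E × E → E) 2 π := by
      rw [← hπ.2] at hμ
      exact hμ.comp_of_map measurable_snd.aemeasurable
    rw [lintegral_enorm_sub_sq_eq_ofReal hfst hsnd]
    exact ENNReal.ofReal_le_ofReal (integral_norm_sub_sq_le_of_subgradient hφ h hμ hg hπ)

/-- Strict convexity of the quadratic cost at the midpoint of two maps. -/
theorem integral_norm_midpoint_sub_sq {α : Type*} [MeasurableSpace α] {μ : Measure α}
    {f g k : α → E} (hf : MemLp f 2 μ) (hg : MemLp g 2 μ) (hk : MemLp k 2 μ) :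
    ∫ x, ‖(2⁻¹ : ℝ) • (f x + g x) - k x‖ ^ 2 ∂μ =
      2⁻¹ * (∫ x, ‖f x - k x‖ ^ 2 ∂μ + ∫ x, ‖g x - k x‖ ^ 2 ∂μ) -
        4⁻¹ * ∫ x, ‖f x - g x‖ ^ 2 ∂μ := by
  have h1 := (hf.sub hk).integrable_norm_pow two_ne_zero
  have h2 := (hg.sub hk).integrable_norm_pow two_ne_zero
  have h3 := (hf.sub hg).integrable_norm_pow two_ne_zero
  simp only [Pi.sub_apply] at h1 h2 h3
  rw [← integral_add h1 h2, ← integral_const_mul, ← integral_const_mul,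
    ← integral_sub ((h1.fun_add h2).const_mul _) (h3.const_mul _)]
  refine integral_congr_ae (Filter.Eventually.of_forall fun x => ?_)
  have hmid : (2⁻¹ : ℝ) • (f x + g x) - k x = (2⁻¹ : ℝ) • ((f x - k x) + (g x - k x)) := by
    module
  have hpar := parallelogram_law_with_norm ℝ (f x - k x) (g x - k x)
  rw [sub_sub_sub_cancel_right] at hpar
  simp only [hmid, norm_smul, mul_pow]
  norm_num
  linarith

end ConvexGradients

/-- Continuous functions that agree almost everywhere agree on the support of the measure. -/
theorem Continuous.eq_on_support_of_ae_eq {X Y : Type*} [TopologicalSpace X] [MeasurableSpace X]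
    [TopologicalSpace Y] [T2Space Y] {μ : Measure X} {f g : X → Y} (hf : Continuous f)
    (hg : Continuous g) (h : f =ᵐ[μ] g) : Set.EqOn f g μ.support :=
  Measure.support_subset_of_isClosed (isClosed_eq hf hg) h

theorem wasserstein2_sq {d : ℕ} (ν₁ ν₂ : Measure (EuclideanSpace ℝ (Fin d))) :
    wasserstein2 ν₁ ν₂ ^ 2 = transportCost (fun x y => ‖x - y‖ₑ ^ 2) ν₁ ν₂ := by
  rw [wasserstein2, ← ENNReal.rpow_natCast, ← ENNReal.rpow_mul]
  norm_num

/-- The quadratic transport cost of a Lipschitz gradient of a convex function. -/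
theorem wasserstein2_map_sq_of_mem_lipschitzConvexGradients {d : ℕ} {L : ℝ≥0}
    {μ : Measure (EuclideanSpace ℝ (Fin d))} [IsFiniteMeasure μ] (hμ : MemLp id 2 μ)
    {g : EuclideanSpace ℝ (Fin d) → EuclideanSpace ℝ (Fin d)}
    (hg : g ∈ lipschitzConvexGradients d L) :
    wasserstein2 (μ.map g) μ ^ 2 = ENNReal.ofReal (∫ x, ‖g x - x‖ ^ 2 ∂μ) := by
  obtain ⟨hL, φ, hφ, hgrad⟩ := hg
  rw [wasserstein2_sq]
  exact transportCost_map_eq_of_subgradient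
    (continuousOn_univ.1 (hφ.continuousOn isOpen_univ))
    (hφ.add_inner_le_of_ae_hasGradientAt hL.continuous hgrad) hμ hL.continuous.measurable
    (hL.memLp_of_memLp_id hμ)

/-- The class of Lipschitz gradients of convex functions is stable under midpoints. -/
theorem midpoint_mem_lipschitzConvexGradients {d : ℕ} {L : ℝ≥0}
    {g₀ g₁ : EuclideanSpace ℝ (Fin d) → EuclideanSpace ℝ (Fin d)}
    (h₀ : g₀ ∈ lipschitzConvexGradients d L) (h₁ : g₁ ∈ lipschitzConvexGradients d L) :
    (fun x => (2⁻¹ : ℝ) • (g₀ x + g₁ x)) ∈ lipschitzConvexGradients d L := by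
  obtain ⟨hL₀, φ₀, hφ₀, hg₀⟩ := h₀
  obtain ⟨hL₁, φ₁, hφ₁, hg₁⟩ := h₁
  refine ⟨LipschitzWith.of_dist_le_mul fun x y => ?_, fun x => (2⁻¹ : ℝ) • (φ₀ + φ₁) x,
    (hφ₀.add hφ₁).smul (by norm_num), ?_⟩
  · have h0 := hL₀.dist_le_mul x y
    have h1 := hL₁.dist_le_mul x y
    have h2 := dist_add_add_le (g₀ x) (g₁ x) (g₀ y) (g₁ y)
    rw [dist_smul₀, Real.norm_of_nonneg (by norm_num)]
    linarith
  · filter_upwards [hg₀, hg₁] with x hx₀ hx₁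
    rw [hasGradientAt_iff_hasFDerivAt] at hx₀ hx₁ ⊢
    have := (hx₀.add hx₁).const_smul (2⁻¹ : ℝ)
    rw [map_smul, map_add]
    exact this

theorem mainTheorem5 (d : ℕ) (L : ℝ≥0) (μ : Measure (EuclideanSpace ℝ (Fin d)))
    [IsProbabilityMeasure μ] (hμ₂ : MemLp id 2 μ) (hμ : μ ≪ volume)
    (g₀ g₁ : EuclideanSpace ℝ (Fin d) → EuclideanSpace ℝ (Fin d))
    (h₀ : IsMapProblemSolution (lipschitzConvexGradients d L) μ μ g₀)
    (h₁ : IsMapProblemSolution (lipschitzConvexGradients d L) μ μ g₁) :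
    ∀ x ∈ μ.support, g₀ x = g₁ x := by
  obtain ⟨hG₀, hmin₀⟩ := h₀
  obtain ⟨hG₁, hmin₁⟩ := h₁
  have hLp₀ : MemLp g₀ 2 μ := hG₀.1.memLp_of_memLp_id hμ₂
  have hLp₁ : MemLp g₁ 2 μ := hG₁.1.memLp_of_memLp_id hμ₂
  have hGm := midpoint_mem_lipschitzConvexGradients hG₀ hG₁
  have hle₀ := hmin₀ _ hGm
  have hle₁ := hmin₁ _ hGm
  rw [wasserstein2_map_sq_of_mem_lipschitzConvexGradients hμ₂ hGm,
    wasserstein2_map_sq_of_mem_lipschitzConvexGradients hμ₂ ‹_›,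
    ENNReal.ofReal_le_ofReal_iff (integral_nonneg fun x => by positivity)] at hle₀ hle₁
  have hmid := integral_norm_midpoint_sub_sq hLp₀ hLp₁ hμ₂
  simp only [id_eq] at hmid
  have hint : Integrable (fun x => ‖g₀ x - g₁ x‖ ^ 2) μ :=
    (hLp₀.sub hLp₁).integrable_norm_pow two_ne_zero
  have hnonneg : 0 ≤ ∫ x, ‖g₀ x - g₁ x‖ ^ 2 ∂μ := integral_nonneg fun x => by positivity
  -- The midpoint costs the average of the two costs minus a quarter of this integral, yet no less
  -- than either of them.
  have hzero : ∫ x, ‖g₀ x - g₁ x‖ ^ 2 ∂μ = 0 := by linarith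
  have hae : g₀ =ᵐ[μ] g₁ := by
    filter_upwards [(integral_eq_zero_iff_of_nonneg (fun x => by positivity) hint).1 hzero] with x hx
    simpa [sub_eq_zero] using hx
  exact fun x hx => hG₀.1.continuous.eq_on_support_of_ae_eq hG₁.1.continuous hae hx
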